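/- Let $m\ge 0$ be an integer, let $\mathbb R^m$ carry the Euclidean norm and let $m\times m$ matrices carry the spectral norm. Let $\omega>0$, let $p$ be a natural number, and let $\{\theta_k\}_{k\in\mathbb Z}$ be a strictly increasing sequence of real numbers with $\theta_{k+p}=\theta_k+\omega$ for all $k\in\mathbb Z$. Let $A,B\in\mathbb R^{m\times m}$, let $f:\mathbb R\times\mathbb R^m\to\mathbb R^m$ and $h:\mathbb R^m\to\mathbb R^m$ be continuous with $f(t+\omega,x)=f(t,x)$ for all $t,x$, and let $\{\sigma_k\}_{k\in\mathbb Z}$ be a sequence in $\mathbb R^m$ with $\sup_k\|\sigma_k\|\le M_\sigma$ for some $M_\sigma>0$. Define $g:\mathbb R\to\mathbb R^m$ by $g(t)=\sigma_k$ for $t\in(\theta_{kp},\theta_{(k+1)p}]$, $k\in\mathbb Z$, and consider the impulsive system $$\frac{dx}{dt}=Ax+f(t,x)+g(t),\quad t\ne\theta_k,\qquad \Delta x|_{t=\theta_k}=Bx(\theta_k)+h(x(\theta_k)),\qquad(\ast)$$ where $\Delta x|_{t=\theta_k}=x(\theta_k+)-x(\theta_k)$ and solutions are left-continuous at the points $\theta_k$.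 Let $U(t,s)$, $t\ge s$, with $U(s,s)=I$, be the matriciant of the linear system $\frac{dx}{dt}=Ax$ ($t\neq\theta_k$), $\Delta x|_{t=\theta_k}=Bx(\theta_k)$. Assume: - **(A1)** $AB=BA$ and $\det(I+B)\ne0$; - **(A2)** all eigenvalues of $A+\frac p\omega\log(I+B)$ have negative real parts, where $\log$ is the principal matrix logarithm (eigenvalues with imaginary part in $(-\pi,\pi]$); - **(A3)** there are $M_f,M_h>0$ with $\|f(t,x)\|\le M_f$ and $\|h(x)\|\le M_h$ for all $t\in\mathbb R$, $x\in\mathbb R^m$; - **(A4)** $L_f,L_h>0$ satisfy $\|f(t,x_1)-f(t,x_2)\|\le L_f\|x_1-x_2\|$ and $\|h(x_1)-h(x_2)\|\le L_h\|x_1-x_2\|$ for all $t\in\mathbb R$, $x_1,x_2\in\mathbb R^m$; and, with $N,\lambda>0$ denoting numbers such that $\|U(t,s)\|\le Ne^{-\lambda(t-s)}$ for all $t\ge s$, - **(A5)** $N\left(\frac{L_f}{\lambda}+\frac{pL_h}{1-e^{-\lambda\omega}}\right)<1$; - **(A6)** $NL_f+\frac p\omega\ln(1+NL_h)<\lambda$.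 Suppose that $\{\zeta_n\}_{n\in\mathbb N}$ is a sequence of positive integers diverging to infinity such that $\|\sigma_{k+\zeta_n}-\sigma_k\|\to0$ as $n\to\infty$ for each $k$ in bounded intervals of integers (that is, for every $k\in\mathbb Z$). If $\phi:\mathbb R\to\mathbb R^m$ is a solution of $(\ast)$ that is bounded on the whole real axis, then $\|\phi(t+\omega\zeta_n)-\phi(t)\|\to0$ as $n\to\infty$ uniformly on compact subsets of $\mathbb R$. -/

import Mathlib

open Set Filter Topology
open scoped Matrix.Norms.L2Operator

/-- The perturbation `g : ℝ → E` built from a sequence `(σ k)`: it is the step function with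
`g t = σ k` for `t ∈ (θ (k p), θ ((k + 1) p)]`, `k ∈ ℤ`. -/
noncomputable def stepPerturbation {E : Type*} [AddCommMonoid E]
    (θ : ℤ → ℝ) (p : ℕ) (σ : ℤ → E) (t : ℝ) : E :=
  ∑ᶠ k : ℤ, (Ioc (θ (k * p)) (θ ((k + 1) * p))).indicator (fun _ => σ k) t

theorem stepPerturbation_eq {E : Type*} [AddCommMonoid E] {θ : ℤ → ℝ} (hθ : StrictMono θ)
    (p : ℕ) (σ : ℤ → E) {k : ℤ} {t : ℝ} (ht : t ∈ Ioc (θ (k * p)) (θ ((k + 1) * p))) :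
    stepPerturbation θ p σ t = σ k := by
  unfold stepPerturbation
  rw [finsum_eq_single _ k, indicator_of_mem ht]
  intro j hj
  apply indicator_of_notMem
  rintro ⟨h1, h2⟩
  have key : ∀ a b : ℤ, a < b → θ ((a + 1) * p) ≤ θ (b * p) := fun a b hab =>
    hθ.monotone (mul_le_mul_of_nonneg_right (by omega) (by positivity))
  rcases lt_or_gt_of_ne hj with h | h
  · exact absurd (lt_of_lt_of_le ht.1 (h2.trans (key _ _ h))) (lt_irrefl _)
  · exact absurd (lt_of_lt_of_le h1 (ht.2.trans (key _ _ h))) (lt_irrefl _)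

/-- `x : ℝ → ℝᵐ` is a solution, on the whole real axis, of the impulsive system
`x' = A x + f(t, x) + g(t)` for `t ≠ θ k`, `Δx|_{t = θ k} = B x(θ k) + h(x(θ k))`,
where `Δx|_{t = θ k} = x(θ k +) - x(θ k)`. As usual, solutions are left-continuous at the
impulse moments. -/
structure IsImpulsiveSolution {m : ℕ} (A B : Matrix (Fin m) (Fin m) ℝ)
    (f : ℝ → EuclideanSpace ℝ (Fin m) → EuclideanSpace ℝ (Fin m))
    (g : ℝ → EuclideanSpace ℝ (Fin m))
    (h : EuclideanSpace ℝ (Fin m) → EuclideanSpace ℝ (Fin m))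
    (θ : ℤ → ℝ) (x : ℝ → EuclideanSpace ℝ (Fin m)) : Prop where
  hasDerivAt : ∀ t : ℝ, t ∉ range θ →
    HasDerivAt x (Matrix.toEuclideanCLM (𝕜 := ℝ) A (x t) + f t (x t) + g t) t
  left_cont : ∀ k : ℤ, Tendsto x (𝓝[<] (θ k)) (𝓝 (x (θ k)))
  jump : ∀ k : ℤ, Tendsto x (𝓝[>] (θ k))
    (𝓝 (x (θ k) + (Matrix.toEuclideanCLM (𝕜 := ℝ) B (x (θ k)) + h (x (θ k)))))

/-- `U` is (forward in time, `t ≥ s`) the matriciant of the linear impulsive system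
`x' = A x` for `t ≠ θ k`, `Δx|_{t = θ k} = B x(θ k)`: for every `s`, the matrix function
`t ↦ U t s` on `[s, ∞)` solves the system, is left-continuous at the impulse moments
after `s`, and `U s s = I`. If `s` itself is an impulse moment, the jump at `s` takes place
immediately after `s`. -/
structure IsMatriciant {m : ℕ} (A B : Matrix (Fin m) (Fin m) ℝ) (θ : ℤ → ℝ)
    (U : ℝ → ℝ → Matrix (Fin m) (Fin m) ℝ) : Prop where
  init : ∀ s : ℝ, U s s = 1
  hasDerivWithinAt : ∀ s t : ℝ, s ≤ t → t ∉ range θ →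
    HasDerivWithinAt (fun τ => U τ s) (A * U t s) (Ici s) t
  left_cont : ∀ (s : ℝ) (k : ℤ), s < θ k →
    Tendsto (fun τ => U τ s) (𝓝[<] (θ k)) (𝓝 (U (θ k) s))
  jump : ∀ (s : ℝ) (k : ℤ), s ≤ θ k →
    Tendsto (fun τ => U τ s) (𝓝[>] (θ k)) (𝓝 (U (θ k) s + B * U (θ k) s))

/-- `L` is the principal logarithm of the complex matrix `M`: `exp L = M` and the eigenvalues
of `L` lie in the strip `-π < Im z ≤ π`. Such an `L` exists and is unique whenever `M` is
invertible. -/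
def IsPrincipalMatrixLog {m : ℕ} (M L : Matrix (Fin m) (Fin m) ℂ) : Prop :=
  NormedSpace.exp L = M ∧ ∀ z ∈ spectrum ℂ L, -Real.pi < z.im ∧ z.im ≤ Real.pi

/-!
A shift by `ζ` periods of a solution `φ` solves the same system with `σ k` replaced by
`σ (k + ζ)`. Hence the difference `ψ(t) = φ(t + ω ζ) - φ(t)` solves the linear impulsive equation
with forcing at most `Lf ‖ψ‖ + ‖σ (k + ζ) - σ k‖` and jump forcing at most `Lh ‖ψ‖`
(`IsImpulsiveSolution.sub_shift`).

By variation of constants and the exponential decay of the matriciant, if `‖ψ‖ ≤ S` on `[s, d]`,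
then for `t ∈ [s, d]`
`‖ψ t‖ ≤ N exp(-lam (t - s)) ‖ψ s‖ + κ S + N ε / lam`, with
`κ = N (Lf / lam + p Lh / (1 - exp(-lam ω)))`,
where `ε` bounds `‖σ (k + ζ) - σ k‖` over the finitely many `k` relevant to `[s, d]`. The second
summand of `κ` comes from summing `exp(-lam (t - θ k))` over `θ k < t` in blocks of one period.
As `κ < 1`, and as `ψ` is bounded uniformly in `ζ`, finitely many applications of this estimate
on intervals whose left end moves to the right by a fixed length make `ψ` as small as desired
on a given compact set (`exists_window_norm_lt`), once `ε` is small.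

The matriciant is assumed to solve the linear system in its first variable only. The function
`E(r) = exp(-r A) (1 + B) ^ (-n r)`, where `n r` counts the impulse moments before `r`, is an
integrating factor because `A` and `B` commute, and `U(t, s) = E(t)⁻¹ E(s)`
(`integratingFactor_mul_eq`) describes `U(t, s)` as a function of `s`. Both this identity and the
variation of constants estimate (`norm_le_of_linear_impulsive`) follow from a mean value inequality
for functions with jumps (`norm_sub_le_of_piecewise`), without integration.
-/

/-! ### Counting impulse moments -/

theorem apply_add_mul_period {θ : ℤ → ℝ} {ω : ℝ} {p : ℕ}
    (hper : ∀ k : ℤ, θ (k + p) = θ k + ω) (j k : ℤ) : θ (k + j * p) = θ k + j * ω := by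
  induction j with
  | zero => simp
  | succ i ih =>
    rw [show k + ((i : ℤ) + 1) * p = k + i * p + p by ring, hper, ih]; push_cast; ring
  | pred i ih =>
    have := hper (k + (-(i : ℤ) - 1) * p)
    rw [show k + (-(i : ℤ) - 1) * p + p = k + -(i : ℤ) * p by ring, ih] at this
    push_cast at this ⊢
    linarith

/-- Since the moments tend to `±∞`, one can count them from a base point: `n r` is the index of the
first moment not before `r`, so that the moments in `[s, t)` are indexed by `[n s, n t)`. -/
theorem exists_count_lt {θ : ℤ → ℝ} (hθ : StrictMono θ) {ω : ℝ} (hω : 0 < ω) {p : ℕ}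
    (hper : ∀ k : ℤ, θ (k + p) = θ k + ω) :
    ∃ n : ℝ → ℤ, ∀ r k, θ k < r ↔ k < n r := by
  have hmul := fun j => apply_add_mul_period hper j
  have key : ∀ r : ℝ, ∃ n : ℤ, ∀ k, θ k < r ↔ k < n := by
    intro r
    have hlow : ∃ b : ℤ, ∀ z : ℤ, r ≤ θ z → b ≤ z := by
      obtain ⟨j, hj⟩ := exists_int_lt ((r - θ 0) / ω)
      refine ⟨0 + j * p, fun z hz => ?_⟩
      rw [lt_div_iff₀ hω] at hj
      by_contra! hlt
      have := hθ hlt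
      rw [hmul] at this
      linarith
    have hex : ∃ z : ℤ, r ≤ θ z := by
      obtain ⟨j, hj⟩ := exists_int_gt ((r - θ 0) / ω)
      refine ⟨0 + j * p, ?_⟩
      rw [div_lt_iff₀ hω] at hj
      rw [hmul]
      linarith
    obtain ⟨n, hn, hmin⟩ := Int.exists_least_of_bdd hlow hex
    refine ⟨n, fun k => ⟨fun hk => hθ.lt_iff_lt.1 (hk.trans_le hn), fun hk => ?_⟩⟩
    by_contra! h
    exact absurd (hmin k h) (not_le.2 hk)
  choose n hn using key
  exact ⟨n, hn⟩

section Count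

variable {θ : ℤ → ℝ} {n : ℝ → ℤ}

theorem count_mono (hn : ∀ r k, θ k < r ↔ k < n r) {r s : ℝ} (h : r ≤ s) : n r ≤ n s := by
  by_contra! hlt
  exact lt_irrefl _ ((hn s _).1 (((hn r _).2 hlt).trans_le h))

theorem count_eq_of_mem_Ioc (hn : ∀ r k, θ k < r ↔ k < n r) {r : ℝ} {k : ℤ}
    (hr : r ∈ Ioc (θ k) (θ (k + 1))) : n r = k + 1 := by
  have h1 := (hn r k).1 hr.1
  have h2 := (hn r (k + 1)).not.1 (not_lt.2 hr.2)
  omega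

theorem mem_Ioc_count (hn : ∀ r k, θ k < r ↔ k < n r) (r : ℝ) :
    r ∈ Ioc (θ (n r - 1)) (θ (n r)) :=
  ⟨(hn r _).2 (by omega), not_lt.1 ((hn r _).not.2 (lt_irrefl _))⟩

theorem count_apply (hθ : StrictMono θ) (hn : ∀ r k, θ k < r ↔ k < n r) (k : ℤ) :
    n (θ k) = k := by
  have h := count_eq_of_mem_Ioc hn (k := k - 1) (r := θ k)
    ⟨hθ (by omega), le_of_eq (by congr 1; omega)⟩
  omega

theorem count_eventually_nhdsGT (hθ : StrictMono θ) (hn : ∀ r k, θ k < r ↔ k < n r) (k : ℤ) :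
    ∀ᶠ r in 𝓝[>] (θ k), n r = k + 1 := by
  filter_upwards [Ioc_mem_nhdsGT (hθ (lt_add_one k))] with r hr
  exact count_eq_of_mem_Ioc hn hr

theorem count_eventually_nhdsLT (hθ : StrictMono θ) (hn : ∀ r k, θ k < r ↔ k < n r) (k : ℤ) :
    ∀ᶠ r in 𝓝[<] (θ k), n r = n (θ k) := by
  filter_upwards [Ioo_mem_nhdsLT (hθ (sub_one_lt k))] with r hr
  rw [count_apply hθ hn]
  have := count_eq_of_mem_Ioc hn (k := k - 1) (r := r) ⟨hr.1, by
    rw [sub_add_cancel]; exact hr.2.le⟩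
  omega

theorem count_eventually_nhds (hn : ∀ r k, θ k < r ↔ k < n r) {r : ℝ} (hr : r ∉ range θ) :
    ∀ᶠ u in 𝓝 r, n u = n r := by
  have h := mem_Ioc_count hn r
  have h2 : r < θ (n r) := lt_of_le_of_ne h.2 fun e => hr ⟨_, e.symm⟩
  filter_upwards [Ioo_mem_nhds h.1 h2] with u hu
  have := count_eq_of_mem_Ioc hn (k := n r - 1) (r := u) ⟨hu.1, by
    rw [sub_add_cancel]; exact hu.2.le⟩
  omega

end Count

/-! ### The mean value inequality for functions with jumps -/

section MeanValue

variable {F : Type*} [NormedAddCommGroup F] [NormedSpace ℝ F]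

/-- Mean value inequality for a left-continuous function `v` that is differentiable off the moments
`θ k` and has right limits `vR k` there: the increment over `[s, t]` is at most that of a majorant
`β` plus the sum of the bounds `J k` on the jumps in `[s, t)`. -/
theorem norm_sub_le_of_piecewise {θ : ℤ → ℝ} {n : ℝ → ℤ} (hθ : StrictMono θ)
    (hn : ∀ r k, θ k < r ↔ k < n r) {v v' : ℝ → F} {vR : ℤ → F} {β β' : ℝ → ℝ} {J : ℤ → ℝ}
    {s t : ℝ} (hst : s ≤ t)
    (hv : ∀ r ∈ Icc s t, r ∉ range θ → HasDerivWithinAt v (v' r) (Ici s) r)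
    (hleft : ∀ k, s < θ k → Tendsto v (𝓝[<] (θ k)) (𝓝 (v (θ k))))
    (hright : ∀ k, s ≤ θ k → Tendsto v (𝓝[>] (θ k)) (𝓝 (vR k)))
    (hβ : ∀ r, HasDerivAt β (β' r) r)
    (hvβ : ∀ r ∈ Icc s t, r ∉ range θ → ‖v' r‖ ≤ β' r)
    (hJ : ∀ k, s ≤ θ k → θ k < t → ‖vR k - v (θ k)‖ ≤ J k) :
    ‖v t - v s‖ ≤ β t - β s + ∑ k ∈ Finset.Ico (n s) (n t), J k := by
  -- On an interval `[x, y]` without impulse moments in `[x, y)` this is the mean value inequality.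
  have smooth : ∀ x y, s ≤ x → x ≤ y → y ≤ t → (∀ r ∈ Ico x y, r ∉ range θ) →
      ‖v y - v x‖ ≤ β y - β x := by
    intro x y hsx hxy hyt hxyθ
    have hder : ∀ r ∈ Ico x y, HasDerivWithinAt v (v' r) (Ici r) r := fun r hr =>
      (hv r ⟨hsx.trans hr.1, hr.2.le.trans hyt⟩ (hxyθ r hr)).mono
        (Ici_subset_Ici.2 (hsx.trans hr.1))
    have hcont : ContinuousOn v (Icc x y) := by
      intro r hr
      by_cases hrθ : r ∈ range θ
      · obtain ⟨k, rfl⟩ := hrθ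
        have hky : θ k = y := by
          by_contra hne
          exact hxyθ _ ⟨hr.1, lt_of_le_of_ne hr.2 hne⟩ ⟨k, rfl⟩
        rcases hr.1.eq_or_lt with hx | hx
        · rw [show Icc x y = {θ k} by rw [← hky, ← hx, Icc_self]]
          exact continuousWithinAt_singleton
        · have h1 : ContinuousWithinAt v (Iio (θ k)) (θ k) := hleft k (hsx.trans_lt hx)
          have h2 := continuousWithinAt_insert_self.2 h1
          rw [Iio_insert] at h2
          exact h2.mono fun u hu => hky ▸ hu.2
      · exact (hv r ⟨hsx.trans hr.1, hr.2.trans hyt⟩ hrθ).continuousWithinAt.mono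
          fun u hu => hsx.trans hu.1
    have := image_norm_le_of_norm_deriv_right_le_deriv_boundary (f := fun r => v r - v x)
      (f' := v') (B := fun r => β r - β x) (B' := β') (a := x) (b := y)
      (hcont.sub continuousOn_const) (fun r hr => (hder r hr).sub_const _) (by simp)
      (fun r => (hβ r).sub_const _)
      (fun r hr => hvβ r ⟨hsx.trans hr.1, hr.2.le.trans hyt⟩ (hxyθ r hr))
    exact this ⟨hxy, le_rfl⟩
  -- Induction on the number of moments in `[s, y)`, removing the last one.
  have main : ∀ (i : ℕ) (y : ℝ), s ≤ y → y ≤ t → n y = n s + i →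
      ‖v y - v s‖ ≤ β y - β s + ∑ k ∈ Finset.Ico (n s) (n y), J k := by
    intro i
    induction i with
    | zero =>
      intro y hsy hyt hny
      have hny : n y = n s := by simpa using hny
      rw [hny, Finset.Ico_self, Finset.sum_empty, add_zero]
      refine smooth s y le_rfl hsy hyt ?_
      rintro _ hr ⟨k, rfl⟩
      have h1 := (hn y k).1 hr.2
      have h2 := (hn s k).not.1 (not_lt.2 hr.1)
      omega
    | succ i ih =>
      intro y hsy hyt hny
      set k : ℤ := n s + i with hk
      have hny : n y = k + 1 := by push_cast at hny; omega
      have hky : θ k < y := (hn y k).2 (by omega)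
      have hsk : s ≤ θ k := not_lt.1 ((hn s k).not.2 (by omega))
      have h1 := ih (θ k) hsk (hky.le.trans hyt) (count_apply hθ hn k)
      rw [count_apply hθ hn] at h1
      have h2 := hJ k hsk (hky.trans_le hyt)
      -- `v` need not be right-continuous at `θ k`; start at `x > θ k` and let `x ↓ θ k`.
      have h3 : ‖v y - vR k‖ ≤ β y - β (θ k) := by
        have t1 : Tendsto (fun x => ‖v y - v x‖) (𝓝[>] (θ k)) (𝓝 ‖v y - vR k‖) :=
          (tendsto_const_nhds.sub (hright k hsk)).norm
        have t2 : Tendsto (fun x => β y - β x) (𝓝[>] (θ k)) (𝓝 (β y - β (θ k))) :=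
          tendsto_const_nhds.sub ((hβ _).continuousAt.tendsto.mono_left nhdsWithin_le_nhds)
        refine le_of_tendsto_of_tendsto t1 t2 ?_
        filter_upwards [Ioo_mem_nhdsGT hky] with x hx
        refine smooth x y (hsk.trans hx.1.le) hx.2.le hyt ?_
        rintro _ hr ⟨l, rfl⟩
        have h5 := (hn y l).1 hr.2
        have h6 := hθ.lt_iff_lt.1 (hx.1.trans_le hr.1)
        omega
      have h4 : ∑ l ∈ Finset.Ico (n s) (n y), J l
          = ∑ l ∈ Finset.Ico (n s) k, J l + J k := by
        have : Finset.Ico (n s) (n y) = insert k (Finset.Ico (n s) k) := by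
          ext l; simp only [Finset.mem_Ico, Finset.mem_insert]; omega
        rw [this, Finset.sum_insert (by simp), add_comm]
      calc ‖v y - v s‖ = ‖(v y - vR k) + (vR k - v (θ k)) + (v (θ k) - v s)‖ := by
            congr 1; abel
        _ ≤ ‖v y - vR k‖ + ‖vR k - v (θ k)‖ + ‖v (θ k) - v s‖ := norm_add₃_le
        _ ≤ _ := by rw [h4]; linarith
  have hle := count_mono hn hst
  exact main (n t - n s).toNat t hst le_rfl (by omega)

end MeanValue

/-! ### A geometric sum over moments, and iteration of estimates -/

theorem sum_exp_neg_count_le {θ : ℤ → ℝ} {n : ℝ → ℤ}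
    (hn : ∀ r k, θ k < r ↔ k < n r) {ω : ℝ} (hω : 0 < ω) {p : ℕ}
    (hper : ∀ k : ℤ, θ (k + p) = θ k + ω) {lam : ℝ} (hlam : 0 < lam) (i : ℤ) (t : ℝ) :
    ∑ k ∈ Finset.Ico i (n t), Real.exp (-lam * (t - θ k)) ≤
      p / (1 - Real.exp (-lam * ω)) := by
  have hp : 0 < p := by
    rcases Nat.eq_zero_or_pos p with rfl | h
    · have := hper 0
      simp at this
      exact absurd this hω.ne'
    · exact h
  set ρ := Real.exp (-lam * ω) with hρ
  have hρ1 : ρ < 1 := Real.exp_lt_one_iff.2 (by nlinarith)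
  have hρ0 : 0 ≤ ρ := (Real.exp_pos _).le
  -- The moments before `t`, read backwards in blocks of `p`: in the `M`-th block `t - θ k ≥ M ω`.
  have block : ∀ M : ℕ, ∑ k ∈ Finset.Ico (n t - M * p) (n t), Real.exp (-lam * (t - θ k)) ≤
      p * ∑ q ∈ Finset.range M, ρ ^ q := by
    intro M
    induction M with
    | zero => simp
    | succ M ih =>
      have hle : n t - ((M + 1 : ℕ) : ℤ) * p ≤ n t - M * p := by push_cast; nlinarith
      have hle' : n t - (M : ℤ) * p ≤ n t := by
        have : (0 : ℤ) ≤ M * p := by positivity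
        omega
      have hsplit : Finset.Ico (n t - ((M + 1 : ℕ) : ℤ) * p) (n t) =
          Finset.Ico (n t - ((M + 1 : ℕ) : ℤ) * p) (n t - M * p) ∪
            Finset.Ico (n t - M * p) (n t) := (Finset.Ico_union_Ico_eq_Ico hle hle').symm
      rw [hsplit, Finset.sum_union (Finset.Ico_disjoint_Ico_consecutive _ _ _),
        Finset.sum_range_succ, mul_add]
      have hblock : ∑ k ∈ Finset.Ico (n t - ((M + 1 : ℕ) : ℤ) * p) (n t - M * p),
          Real.exp (-lam * (t - θ k)) ≤ p * ρ ^ M := by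
        refine (Finset.sum_le_card_nsmul _ _ (ρ ^ M) fun k hk => ?_).trans_eq ?_
        · rw [hρ, ← Real.exp_nat_mul]
          refine Real.exp_le_exp.2 ?_
          have h1 : θ (k + M * p) < t := (hn _ _).2 (by have := (Finset.mem_Ico.1 hk).2; omega)
          rw [apply_add_mul_period hper] at h1
          push_cast at h1
          nlinarith
        · rw [nsmul_eq_mul, Int.card_Ico]
          congr 2
          push_cast
          rw [show n t - (M : ℤ) * p - (n t - (M + 1) * p) = p by ring, Int.toNat_natCast]
      linarith
  have hgeom : ∀ M : ℕ, ∑ q ∈ Finset.range M, ρ ^ q ≤ (1 - ρ)⁻¹ := fun M => by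
    rw [← tsum_geometric_of_lt_one hρ0 hρ1]
    exact (summable_geometric_of_lt_one hρ0 hρ1).sum_le_tsum _ fun _ _ => by positivity
  calc ∑ k ∈ Finset.Ico i (n t), Real.exp (-lam * (t - θ k))
      ≤ ∑ k ∈ Finset.Ico (n t - (n t - i).toNat * p) (n t), Real.exp (-lam * (t - θ k)) := by
        refine Finset.sum_le_sum_of_subset_of_nonneg ?_ fun _ _ _ => (Real.exp_pos _).le
        refine Finset.Ico_subset_Ico_left ?_
        have h1 : (1 : ℤ) ≤ p := by exact_mod_cast hp
        have h2 := Int.self_le_toNat (n t - i)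
        nlinarith
    _ ≤ p * (1 - ρ)⁻¹ := (block _).trans (by gcongr; exact hgeom _)
    _ = _ := (div_eq_mul_inv _ _).symm

/-- Each step gives up an interval of length `Δ` at the left end of `[s₀, b]` and turns a bound `S`
into `δ + κ S`; iterating from the a priori bound `D` approaches the fixed point `δ / (1 - κ)`. -/
theorem norm_le_pow_add_of_windows {F : Type*} [NormedAddCommGroup F] {ψ : ℝ → F}
    {s₀ b D Δ δ κ : ℝ} (hD : ∀ t, ‖ψ t‖ ≤ D) (hΔ : 0 ≤ Δ) (hδ : 0 ≤ δ) (hκ : κ < 1)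
    (step : ∀ s S t, s₀ ≤ s → s + Δ ≤ t → t ≤ b → (∀ r ∈ Icc s b, ‖ψ r‖ ≤ S) →
      ‖ψ t‖ ≤ δ + κ * S) (j : ℕ) :
    ∀ t ∈ Icc (s₀ + j * Δ) b, ‖ψ t‖ ≤ κ ^ j * D + δ / (1 - κ) := by
  have h1 : 0 < 1 - κ := by linarith
  induction j with
  | zero =>
    intro t _
    have : 0 ≤ δ / (1 - κ) := by positivity
    rw [pow_zero, one_mul]
    linarith [hD t]
  | succ j ih =>
    intro t ht
    have := step (s₀ + j * Δ) _ t (le_add_of_nonneg_right (by positivity))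
      (by have := ht.1; push_cast at this; linarith) ht.2 ih
    refine this.trans_eq ?_
    field_simp
    ring

/-! ### The integrating factor of the linear equation -/

section IntegratingFactor

variable {R : Type*} [NormedRing R] [NormedAlgebra ℝ R]

/-- The integrating factor `r ↦ exp(-r a) J ^ (-n r)` of the linear impulsive equation `x' = a x`
with jumps `x ↦ J x`, where `n r` counts the impulse moments before `r`. -/
noncomputable def integratingFactor (a : R) (J : Rˣ) (n : ℝ → ℤ) (r : ℝ) : R :=
  NormedSpace.exp ((-r) • a) * ↑(J ^ (-n r))

/-- The right limit of `integratingFactor` at the impulse moment `θ k`. -/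
noncomputable def integratingFactorRight (a : R) (J : Rˣ) (θ : ℤ → ℝ) (k : ℤ) : R :=
  NormedSpace.exp ((-θ k) • a) * ↑(J ^ (-(k + 1)))

variable {a : R} {J : Rˣ} {θ : ℤ → ℝ} {n : ℝ → ℤ}

theorem integratingFactorRight_mul (hθ : StrictMono θ) (hn : ∀ r k, θ k < r ↔ k < n r) (k : ℤ) :
    integratingFactorRight a J θ k * J = integratingFactor a J n (θ k) := by
  rw [integratingFactorRight, integratingFactor, count_apply hθ hn, mul_assoc, ← Units.val_mul,
    ← zpow_add_one]
  congr 3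
  omega

variable [CompleteSpace R]

theorem hasDerivAt_exp_neg_smul (a : R) (r : ℝ) :
    HasDerivAt (fun r : ℝ => NormedSpace.exp ((-r) • a)) (-(NormedSpace.exp ((-r) • a) * a)) r := by
  have h := (hasDerivAt_exp_smul_const a (-r)).scomp r (hasDerivAt_neg r)
  simpa [Function.comp_def] using h

theorem isUnit_integratingFactor (a : R) (J : Rˣ) (n : ℝ → ℤ) (r : ℝ) :
    IsUnit (integratingFactor a J n r) := by
  refine IsUnit.mul (NormedSpace.isUnit_exp_of_mem_ball (𝕂 := ℝ) ?_) (Units.isUnit _)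
  rw [NormedSpace.expSeries_radius_eq_top]
  exact edist_lt_top _ _

theorem hasDerivAt_integratingFactor (haJ : Commute a J) (hn : ∀ r k, θ k < r ↔ k < n r) {r : ℝ}
    (hr : r ∉ range θ) :
    HasDerivAt (integratingFactor a J n) (-(integratingFactor a J n r * a)) r := by
  have h := (hasDerivAt_exp_neg_smul a r).mul_const (↑(J ^ (-n r)) : R)
  have hval : -(NormedSpace.exp ((-r) • a) * a) * (↑(J ^ (-n r)) : R) =
      -(integratingFactor a J n r * a) := by
    rw [integratingFactor, neg_mul, mul_assoc, mul_assoc, (haJ.units_zpow_right (-n r)).eq]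
  rw [hval] at h
  refine h.congr_of_eventuallyEq ?_
  filter_upwards [count_eventually_nhds hn hr] with u hu
  rw [integratingFactor, hu]

theorem tendsto_integratingFactor_nhdsLT (hθ : StrictMono θ) (hn : ∀ r k, θ k < r ↔ k < n r)
    (k : ℤ) : Tendsto (integratingFactor a J n) (𝓝[<] (θ k))
      (𝓝 (integratingFactor a J n (θ k))) := by
  have h : Tendsto (fun r : ℝ => NormedSpace.exp ((-r) • a)) (𝓝[<] (θ k)) _ :=
    (hasDerivAt_exp_neg_smul a (θ k)).continuousAt.tendsto.mono_left nhdsWithin_le_nhds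
  refine (h.mul_const (↑(J ^ (-n (θ k))) : R)).congr' ?_
  filter_upwards [count_eventually_nhdsLT hθ hn k] with u hu
  rw [integratingFactor, hu]

theorem tendsto_integratingFactor_nhdsGT (hθ : StrictMono θ) (hn : ∀ r k, θ k < r ↔ k < n r)
    (k : ℤ) : Tendsto (integratingFactor a J n) (𝓝[>] (θ k))
      (𝓝 (integratingFactorRight a J θ k)) := by
  have h : Tendsto (fun r : ℝ => NormedSpace.exp ((-r) • a)) (𝓝[>] (θ k)) _ :=
    (hasDerivAt_exp_neg_smul a (θ k)).continuousAt.tendsto.mono_left nhdsWithin_le_nhds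
  refine (h.mul_const (↑(J ^ (-(k + 1))) : R)).congr' ?_
  filter_upwards [count_eventually_nhdsGT hθ hn k] with u hu
  rw [integratingFactor, hu]

/-- The integrating factor makes every fundamental solution constant. Its product with `Y` has zero
derivative, and no jumps because the factor `J⁻¹` it picks up at `θ k` cancels `1 + b`. Hence
`Y t s = E(t)⁻¹ E(s)`, which gives control of `Y t s` as a function of `s`. -/
theorem integratingFactor_mul_eq {b : R} (haJ : Commute a J) (hJ : (J : R) = 1 + b)
    (hθ : StrictMono θ) (hn : ∀ r k, θ k < r ↔ k < n r) {Y : ℝ → R} {s t : ℝ} (hst : s ≤ t)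
    (hY0 : Y s = 1)
    (hY : ∀ r, s ≤ r → r ∉ range θ → HasDerivWithinAt Y (a * Y r) (Ici s) r)
    (hYl : ∀ k, s < θ k → Tendsto Y (𝓝[<] (θ k)) (𝓝 (Y (θ k))))
    (hYr : ∀ k, s ≤ θ k → Tendsto Y (𝓝[>] (θ k)) (𝓝 (Y (θ k) + b * Y (θ k)))) :
    integratingFactor a J n t * Y t = integratingFactor a J n s := by
  have h := norm_sub_le_of_piecewise hθ hn (v := fun r => integratingFactor a J n r * Y r)
    (v' := fun _ => 0)
    (vR := fun k => integratingFactorRight a J θ k * (Y (θ k) + b * Y (θ k)))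
    (β := fun _ => 0) (β' := fun _ => 0) (J := fun _ => 0) hst
    (fun r hr hrθ => by
      have := (hasDerivAt_integratingFactor haJ hn hrθ).hasDerivWithinAt.mul (hY r hr.1 hrθ)
      refine this.congr_deriv ?_
      rw [neg_mul, mul_assoc, neg_add_cancel])
    (fun k hk => (tendsto_integratingFactor_nhdsLT hθ hn k).mul (hYl k hk))
    (fun k hk => (tendsto_integratingFactor_nhdsGT hθ hn k).mul (hYr k hk))
    (fun r => hasDerivAt_const _ _) (fun _ _ _ => by simp)
    (fun k _ _ => by
      rw [← integratingFactorRight_mul hθ hn k, hJ, mul_assoc, add_mul, one_mul, sub_self, norm_zero])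
  simp only [sub_self, Finset.sum_const_zero, add_zero, norm_le_zero_iff, sub_eq_zero] at h
  rwa [hY0, mul_one] at h

end IntegratingFactor

/-! ### Variation of constants -/

/-- `Y` is the evolution family, forward in time, of the linear impulsive equation `x' = a x` off
the moments `θ k`, with jumps `b x(θ k)` at `θ k`, in a normed algebra. The conventions are those
of `IsMatriciant`: `Y · s` is left-continuous at moments after `s`, and a jump at `s` itself takes
place immediately after `s`. -/
structure IsImpulsiveEvolution {R : Type*} [NormedRing R] [NormedAlgebra ℝ R] (a b : R)
    (θ : ℤ → ℝ) (Y : ℝ → ℝ → R) : Prop where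
  init : ∀ s, Y s s = 1
  hasDerivWithinAt : ∀ s r, s ≤ r → r ∉ range θ →
    HasDerivWithinAt (fun τ => Y τ s) (a * Y r s) (Ici s) r
  left_cont : ∀ s k, s < θ k → Tendsto (fun τ => Y τ s) (𝓝[<] (θ k)) (𝓝 (Y (θ k) s))
  jump : ∀ s k, s ≤ θ k →
    Tendsto (fun τ => Y τ s) (𝓝[>] (θ k)) (𝓝 (Y (θ k) s + b * Y (θ k) s))

/-- `ψ` solves, on the whole line, the linear impulsive equation `ψ' = a ψ + F` off the moments
`θ k`, with jump `b ψ(θ k) + H k` at `θ k` and left-continuity there. -/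
structure IsForcedImpulsiveSolution {X : Type*} [NormedAddCommGroup X] [NormedSpace ℝ X]
    (a b : X →L[ℝ] X) (θ : ℤ → ℝ) (F : ℝ → X) (H : ℤ → X) (ψ : ℝ → X) : Prop where
  hasDerivAt : ∀ r, r ∉ range θ → HasDerivAt ψ (a (ψ r) + F r) r
  left_cont : ∀ k, Tendsto ψ (𝓝[<] (θ k)) (𝓝 (ψ (θ k)))
  jump : ∀ k, Tendsto ψ (𝓝[>] (θ k)) (𝓝 (ψ (θ k) + (b (ψ (θ k)) + H k)))

section VariationOfConstants

variable {X : Type*} [NormedAddCommGroup X] [NormedSpace ℝ X]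

theorem tendsto_apply_of_tendsto {l : Filter ℝ} {S : ℝ → X →L[ℝ] X} {u : ℝ → X} {S₀ : X →L[ℝ] X}
    {u₀ : X} (hS : Tendsto S l (𝓝 S₀)) (hu : Tendsto u l (𝓝 u₀)) :
    Tendsto (fun r => S r (u r)) l (𝓝 (S₀ u₀)) :=
  ((isBoundedBilinearMap_apply (𝕜 := ℝ) (E := X) (F := X)).continuous.tendsto (S₀, u₀)).comp
    (hS.prodMk_nhds hu)

variable [CompleteSpace X]

/-- The estimate that the variation of constants formula would give on `[s, t]`. It is obtained
without integrals: the piecewise mean value inequality is applied to `r ↦ Y t r (ψ r)`, whose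
derivative is `Y t r (F r)` and whose jump at `θ k` is `Y t (θ k +) (H k)`. -/
theorem norm_le_of_linear_impulsive {a b : X →L[ℝ] X} {J : (X →L[ℝ] X)ˣ} (haJ : Commute a J)
    (hJ : (J : X →L[ℝ] X) = 1 + b) {θ : ℤ → ℝ} (hθ : StrictMono θ) {n : ℝ → ℤ}
    (hn : ∀ r k, θ k < r ↔ k < n r) {ω : ℝ} (hω : 0 < ω) {p : ℕ}
    (hper : ∀ k : ℤ, θ (k + p) = θ k + ω) {Y : ℝ → ℝ → X →L[ℝ] X}
    (hY : IsImpulsiveEvolution a b θ Y)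
    {N lam : ℝ} (hN : 0 < N) (hlam : 0 < lam)
    (hYN : ∀ s t, s ≤ t → ‖Y t s‖ ≤ N * Real.exp (-lam * (t - s)))
    {ψ F : ℝ → X} {H : ℤ → X}
    (hψ : IsForcedImpulsiveSolution a b θ F H ψ)
    {s t M M' : ℝ} (hst : s ≤ t) (hF : ∀ r ∈ Icc s t, ‖F r‖ ≤ M) (hM : 0 ≤ M)
    (hH : ∀ k, s ≤ θ k → θ k < t → ‖H k‖ ≤ M') (hM' : 0 ≤ M') :
    ‖ψ t‖ ≤ N * Real.exp (-lam * (t - s)) * ‖ψ s‖ +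
      N * (M / lam + p * M' / (1 - Real.exp (-lam * ω))) := by
  obtain ⟨V, hV⟩ := isUnit_integratingFactor a J n t
  -- `I r` agrees with `Y t r` for `r ≤ t`, but its one-sided limits and derivative in `r` are known.
  set I : ℝ → X →L[ℝ] X := fun r => ↑V⁻¹ * integratingFactor a J n r with hI
  set IR : ℤ → X →L[ℝ] X := fun k => ↑V⁻¹ * integratingFactorRight a J θ k with hIR
  have hIY : ∀ r ≤ t, I r = Y t r := fun r hr => by
    have h := integratingFactor_mul_eq (Y := fun τ => Y τ r) haJ hJ hθ hn hr (hY.init r)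
      (hY.hasDerivWithinAt r) (hY.left_cont r) (hY.jump r)
    simp only [hI, ← h, ← hV]
    exact Units.inv_mul_cancel_left _ _
  have hIN : ∀ r ≤ t, ‖I r‖ ≤ N * Real.exp (-lam * (t - r)) := fun r hr => by
    rw [hIY r hr]; exact hYN r t hr
  have hIlim : ∀ k, Tendsto I (𝓝[>] (θ k)) (𝓝 (IR k)) := fun k =>
    tendsto_const_nhds.mul (tendsto_integratingFactor_nhdsGT hθ hn k)
  have hIRN : ∀ k, θ k < t → ‖IR k‖ ≤ N * Real.exp (-lam * (t - θ k)) := fun k hk => by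
    have hc : Continuous fun r => N * Real.exp (-lam * (t - r)) := by fun_prop
    refine le_of_tendsto_of_tendsto (hIlim k).norm
      ((hc.tendsto (θ k)).mono_left nhdsWithin_le_nhds) ?_
    filter_upwards [Ioo_mem_nhdsGT hk] with r hr using hIN r hr.2.le
  have hIRJ : ∀ k, IR k * J = I (θ k) := fun k => by
    rw [hI, hIR]; simp only [mul_assoc, integratingFactorRight_mul hθ hn k]
  -- The majorant: an antiderivative of the bound on the derivative of `r ↦ I r (ψ r)`.
  have hβ : ∀ r, HasDerivAt (fun r => N * M / lam * Real.exp (-lam * (t - r)))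
      (N * Real.exp (-lam * (t - r)) * M) r := fun r => by
    have h := ((((hasDerivAt_id r).const_sub t).const_mul (-lam)).exp).const_mul (N * M / lam)
    refine h.congr_deriv ?_
    simp only [id]
    field_simp
  have main := norm_sub_le_of_piecewise hθ hn (v := fun r => I r (ψ r)) (v' := fun r => I r (F r))
    (vR := fun k => IR k (ψ (θ k) + (b (ψ (θ k)) + H k)))
    (J := fun k => N * Real.exp (-lam * (t - θ k)) * M') hst
    (fun r _ hrθ => by
      have h := ((hasDerivAt_integratingFactor haJ hn hrθ).const_mul
        (↑V⁻¹ : X →L[ℝ] X)).clm_apply (hψ.hasDerivAt r hrθ)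
      refine (h.congr_deriv ?_).hasDerivWithinAt
      simp [hI])
    (fun k _ => tendsto_apply_of_tendsto
      (tendsto_const_nhds.mul (tendsto_integratingFactor_nhdsLT hθ hn k)) (hψ.left_cont k))
    (fun k _ => tendsto_apply_of_tendsto (hIlim k) (hψ.jump k)) hβ
    (fun r hr _ => (I r).le_of_opNorm_le_of_le (hIN r hr.2) (hF r hr))
    (fun k hk hk' => by
      have : IR k (ψ (θ k) + (b (ψ (θ k)) + H k)) - I (θ k) (ψ (θ k)) = IR k (H k) := by
        rw [← hIRJ, hJ]
        simp [mul_add]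
      rw [this]
      exact (IR k).le_of_opNorm_le_of_le (hIRN k hk') (hH k hk hk'))
  have hIt : I t (ψ t) = ψ t := by rw [hIY t le_rfl, hY.init]; rfl
  have hIs : ‖I s (ψ s)‖ ≤ N * Real.exp (-lam * (t - s)) * ‖ψ s‖ :=
    (I s).le_of_opNorm_le (hIN s hst) _
  have hsum : ∑ k ∈ Finset.Ico (n s) (n t), N * Real.exp (-lam * (t - θ k)) * M' ≤
      N * (p * M' / (1 - Real.exp (-lam * ω))) := by
    rw [← Finset.sum_mul, ← Finset.mul_sum]
    have := sum_exp_neg_count_le hn hω hper hlam (n s) t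
    calc _ ≤ N * (p / (1 - Real.exp (-lam * ω))) * M' := by gcongr
      _ = _ := by ring
  have hβt : N * M / lam * Real.exp (-lam * (t - t)) - N * M / lam * Real.exp (-lam * (t - s)) ≤
      N * (M / lam) := by
    rw [sub_self, mul_zero, Real.exp_zero, mul_one, mul_div_assoc]
    have : 0 ≤ N * (M / lam) * Real.exp (-lam * (t - s)) := by positivity
    linarith
  simp only [hIt] at main
  have htri : ‖ψ t‖ ≤ ‖ψ t - I s (ψ s)‖ + ‖I s (ψ s)‖ := by
    simpa using norm_add_le (ψ t - I s (ψ s)) (I s (ψ s))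
  rw [mul_add]
  linarith

end VariationOfConstants

/-! ### Smallness of bounded solutions on a window -/

section Window

variable {X : Type*} [NormedAddCommGroup X] [NormedSpace ℝ X] [CompleteSpace X]

/-- Uniform smallness on a bounded interval `[c, d]` from smallness of the
inhomogeneity on a longer one: if a solution bounded by `D` is forced by terms that are Lipschitz in
the solution itself, up to an error `ε` on `[s₀, d]`, and the contraction constant is less than `1`,
then the solution is below `η` on `[c, d]`. Here `s₀` and `ε` do not depend on the solution. -/
theorem exists_window_norm_lt {a b : X →L[ℝ] X} {J : (X →L[ℝ] X)ˣ} (haJ : Commute a J)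
    (hJ : (J : X →L[ℝ] X) = 1 + b) {θ : ℤ → ℝ} (hθ : StrictMono θ) {ω : ℝ} (hω : 0 < ω) {p : ℕ}
    (hper : ∀ k : ℤ, θ (k + p) = θ k + ω) {Y : ℝ → ℝ → X →L[ℝ] X}
    (hY : IsImpulsiveEvolution a b θ Y) {N lam : ℝ} (hN : 0 < N) (hlam : 0 < lam)
    (hYN : ∀ s t, s ≤ t → ‖Y t s‖ ≤ N * Real.exp (-lam * (t - s)))
    {Lf Lh : ℝ} (hLf : 0 < Lf) (hLh : 0 < Lh)
    (hκ : N * (Lf / lam + p * Lh / (1 - Real.exp (-lam * ω))) < 1)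
    (D c d : ℝ) {η : ℝ} (hη : 0 < η) :
    ∃ s₀, ∃ ε > 0, ∀ (ψ F : ℝ → X) (H : ℤ → X), IsForcedImpulsiveSolution a b θ F H ψ →
      (∀ t, ‖ψ t‖ ≤ D) → (∀ r ∈ Icc s₀ d, ‖F r‖ ≤ Lf * ‖ψ r‖ + ε) →
      (∀ k, ‖H k‖ ≤ Lh * ‖ψ (θ k)‖) → ∀ t ∈ Icc c d, ‖ψ t‖ < η := by
  obtain ⟨n, hn⟩ := exists_count_lt hθ hω hper
  have hρ : 0 < 1 - Real.exp (-lam * ω) := by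
    have : Real.exp (-lam * ω) < 1 := Real.exp_lt_one_iff.2 (by nlinarith)
    linarith
  set κ := N * (Lf / lam + p * Lh / (1 - Real.exp (-lam * ω))) with hκdef
  have hκ0 : 0 ≤ κ := by positivity
  have hκ1 : 0 < 1 - κ := by linarith
  obtain ⟨j, hj⟩ : ∃ j : ℕ, κ ^ j * D < η / 2 := by
    have h := (tendsto_pow_atTop_nhds_zero_of_lt_one hκ0 hκ).mul_const D
    rw [zero_mul] at h
    exact (h.eventually_lt_const (half_pos hη)).exists
  set δ := η / 2 * (1 - κ) with hδ
  have hδ0 : 0 < δ := by positivity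
  obtain ⟨Δ, hΔ, hΔ0⟩ : ∃ Δ : ℝ, N * Real.exp (-lam * Δ) * D < δ / 2 ∧ 0 ≤ Δ := by
    have h := ((Real.tendsto_exp_atBot.comp
      (tendsto_id.const_mul_atTop_of_neg (neg_lt_zero.2 hlam))).const_mul N).mul_const D
    rw [mul_zero, zero_mul] at h
    exact ((h.eventually_lt_const (half_pos hδ0)).and (eventually_ge_atTop 0)).exists
  -- `ε` makes its contribution `N ε / lam` equal to `δ / 2`.
  refine ⟨c - j * Δ, δ / 2 * lam / N, by positivity, fun ψ F H hψ hD hF hH t ht => ?_⟩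
  have hD0 : 0 ≤ D := (norm_nonneg _).trans (hD 0)
  have key := norm_le_pow_add_of_windows (s₀ := c - j * Δ) (b := d) hD hΔ0 hδ0.le hκ
    (fun s S t hs hst htd hS => by
      have hst' : s ≤ t := by linarith
      have hS0 : 0 ≤ S := (norm_nonneg _).trans (hS s ⟨le_rfl, hst'.trans htd⟩)
      have h := norm_le_of_linear_impulsive haJ hJ hθ hn hω hper hY hN hlam hYN hψ
        (M := Lf * S + δ / 2 * lam / N) (M' := Lh * S) hst'
        (fun r hr => (hF r ⟨hs.trans hr.1, hr.2.trans htd⟩).trans (by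
          gcongr
          exact hS r ⟨hr.1, hr.2.trans htd⟩)) (by positivity)
        (fun k hk hk' => (hH k).trans (by
          gcongr
          exact hS _ ⟨hk, hk'.le.trans htd⟩)) (by positivity)
      have h1 : N * Real.exp (-lam * (t - s)) * ‖ψ s‖ ≤ N * Real.exp (-lam * Δ) * D := by
        have : -lam * (t - s) ≤ -lam * Δ := by nlinarith
        gcongr
        exact hD s
      have h2 : N * ((Lf * S + δ / 2 * lam / N) / lam +
          p * (Lh * S) / (1 - Real.exp (-lam * ω))) = κ * S + δ / 2 := by
        rw [hκdef]
        field_simp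
        ring
      linarith) j t ⟨by linarith [ht.1], ht.2⟩
  have : δ / (1 - κ) = η / 2 := by rw [hδ, mul_div_cancel_right₀ _ hκ1.ne']
  linarith

end Window

/-! ### Period shifts of the impulsive system -/

/-- A shift of the argument of the step function by `j` periods shifts the sequence by `j`. -/
theorem exists_stepPerturbation_index {E : Type*} [AddCommMonoid E] {θ : ℤ → ℝ}
    (hθ : StrictMono θ) {ω : ℝ} (hω : 0 < ω) {p : ℕ}
    (hper : ∀ k : ℤ, θ (k + p) = θ k + ω) :
    ∃ κ : ℝ → ℤ, Monotone κ ∧ ∀ (σ : ℤ → E) (t : ℝ) (j : ℤ),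
      stepPerturbation θ p σ (t + ω * j) = σ (κ t + j) := by
  have hp : 0 < (p : ℤ) := by
    rcases Nat.eq_zero_or_pos p with rfl | h
    · have := hper 0
      simp at this
      exact absurd this hω.ne'
    · exact_mod_cast h
  have hθ' : StrictMono fun k : ℤ => θ (k * p) := fun i j hij =>
    hθ (mul_lt_mul_of_pos_right hij hp)
  obtain ⟨n, hn⟩ := exists_count_lt (p := 1) hθ' hω fun k => by
    rw [← hper]; congr 1; push_cast; ring
  refine ⟨fun t => n t - 1, fun r s h => sub_le_sub_right (count_mono hn h) 1, fun σ t j => ?_⟩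
  have h := mem_Ioc_count hn t
  have hsh := apply_add_mul_period hper j
  refine stepPerturbation_eq hθ p σ ⟨?_, ?_⟩
  · rw [add_mul, hsh]; linarith [h.1]
  · rw [show (n t - 1 + j + 1) * (p : ℤ) = n t * p + j * p by ring, hsh]; linarith [h.2]

theorem IsMatriciant.isImpulsiveEvolution {m : ℕ} {A B : Matrix (Fin m) (Fin m) ℝ} {θ : ℤ → ℝ}
    {U : ℝ → ℝ → Matrix (Fin m) (Fin m) ℝ} (hU : IsMatriciant A B θ U) :
    IsImpulsiveEvolution (Matrix.toEuclideanCLM (𝕜 := ℝ) A) (Matrix.toEuclideanCLM (𝕜 := ℝ) B) θ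
      (fun t s => Matrix.toEuclideanCLM (𝕜 := ℝ) (U t s)) := by
  have hcont : Continuous (Matrix.toEuclideanCLM (n := Fin m) (𝕜 := ℝ)) :=
    (AddMonoidHomClass.isometry_of_norm _ Matrix.l2_opNorm_toEuclideanCLM).continuous
  let T : Matrix (Fin m) (Fin m) ℝ →L[ℝ]
      (EuclideanSpace ℝ (Fin m) →L[ℝ] EuclideanSpace ℝ (Fin m)) :=
    ⟨(Matrix.toEuclideanCLM (n := Fin m) (𝕜 := ℝ)).toAlgEquiv.toLinearMap, hcont⟩
  refine ⟨fun s => ?_, fun s r hs hr => ?_, fun s k hk => ?_, fun s k hk => ?_⟩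
  · rw [hU.init, map_one]
  · have h := T.hasFDerivAt.comp_hasDerivWithinAt r (hU.hasDerivWithinAt s r hs hr)
    exact h.congr_deriv (map_mul (Matrix.toEuclideanCLM (n := Fin m) (𝕜 := ℝ)) A (U r s))
  · exact (hcont.tendsto _).comp (hU.left_cont s k hk)
  · have h := (hcont.tendsto _).comp (hU.jump s k hk)
    rwa [map_add, map_mul] at h

/-- The difference of a solution and its shift by `j` periods solves the linear impulsive equation,
all nonlinear terms being regarded as given forcing. -/
theorem IsImpulsiveSolution.sub_shift {m : ℕ} {A B : Matrix (Fin m) (Fin m) ℝ}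
    {f : ℝ → EuclideanSpace ℝ (Fin m) → EuclideanSpace ℝ (Fin m)}
    {g : ℝ → EuclideanSpace ℝ (Fin m)} {h : EuclideanSpace ℝ (Fin m) → EuclideanSpace ℝ (Fin m)}
    {θ : ℤ → ℝ} {φ : ℝ → EuclideanSpace ℝ (Fin m)} (hφ : IsImpulsiveSolution A B f g h θ φ)
    {ω : ℝ} {p : ℕ} (hper : ∀ k : ℤ, θ (k + p) = θ k + ω) (hf : ∀ t x, f (t + ω) x = f t x)
    (j : ℤ) :
    IsForcedImpulsiveSolution (Matrix.toEuclideanCLM (𝕜 := ℝ) A) (Matrix.toEuclideanCLM (𝕜 := ℝ) B)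
      θ (fun r => f r (φ (r + ω * j)) - f r (φ r) + (g (r + ω * j) - g r))
      (fun k => h (φ (θ k + ω * j)) - h (φ (θ k))) (fun r => φ (r + ω * j) - φ r) := by
  have hθj : ∀ k, θ k + ω * j = θ (k + j * p) := fun k => by
    rw [apply_add_mul_period hper, mul_comm]
  have hfj : ∀ t x, f (t + ω * j) x = f t x := fun t x => by
    have : Function.Periodic (fun t => f t x) ω := fun t => hf t x
    rw [mul_comm]
    exact this.int_mul j t
  refine ⟨fun r hr => ?_, fun k => ?_, fun k => ?_⟩
  · have hr' : r + ω * j ∉ range θ := by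
      rintro ⟨k, hk⟩
      refine hr ⟨k + (-j) * p, ?_⟩
      rw [apply_add_mul_period hper, hk]
      push_cast
      ring
    refine (((hφ.hasDerivAt _ hr').comp_add_const r (ω * j)).sub
      (hφ.hasDerivAt r hr)).congr_deriv ?_
    rw [hfj, map_sub]
    abel
  · have hs : Tendsto (fun r => r + ω * j) (𝓝[<] (θ k)) (𝓝[<] (θ k + ω * j)) := by
      refine tendsto_nhdsWithin_iff.2 ⟨?_, ?_⟩
      · exact ((continuous_add_const _).tendsto (θ k)).mono_left nhdsWithin_le_nhds
      · filter_upwards [self_mem_nhdsWithin] with r hr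
        simpa using hr
    have hl := hφ.left_cont (k + j * p)
    rw [← hθj] at hl
    exact (hl.comp hs).sub (hφ.left_cont k)
  · have hs : Tendsto (fun r => r + ω * j) (𝓝[>] (θ k)) (𝓝[>] (θ k + ω * j)) := by
      refine tendsto_nhdsWithin_iff.2 ⟨?_, ?_⟩
      · exact ((continuous_add_const _).tendsto (θ k)).mono_left nhdsWithin_le_nhds
      · filter_upwards [self_mem_nhdsWithin] with r hr
        simpa using hr
    have hl := hφ.jump (k + j * p)
    rw [← hθj] at hl
    have key := (hl.comp hs).sub (hφ.jump k)
    rwa [add_sub_add_comm, add_sub_add_comm, ← map_sub] at key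

/-! ### Convergence of the shifted solutions -/

theorem lemma3p2 {m : ℕ} (A B : Matrix (Fin m) (Fin m) ℝ)
    (f : ℝ → EuclideanSpace ℝ (Fin m) → EuclideanSpace ℝ (Fin m))
    (h : EuclideanSpace ℝ (Fin m) → EuclideanSpace ℝ (Fin m))
    (θ : ℤ → ℝ) (σ : ℤ → EuclideanSpace ℝ (Fin m)) (ω : ℝ) (p : ℕ)
    (U : ℝ → ℝ → Matrix (Fin m) (Fin m) ℝ)
    (Mσ Mf Mh Lf Lh N lam : ℝ)
    -- standing assumptions on the system
    (hf : Continuous (fun q : ℝ × EuclideanSpace ℝ (Fin m) => f q.1 q.2))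
    (hh : Continuous h)
    (hω : 0 < ω)
    (hf_per : ∀ t x, f (t + ω) x = f t x)
    (hθ : StrictMono θ)
    (hθ_per : ∀ k : ℤ, θ (k + p) = θ k + ω)
    (hMσ : 0 < Mσ) (hσ : ∀ k, ‖σ k‖ ≤ Mσ)
    -- (A1)
    (hA1_comm : A * B = B * A) (hA1_det : (1 + B).det ≠ 0)
    -- (A2)
    (hA2 : ∃ L : Matrix (Fin m) (Fin m) ℂ,
      IsPrincipalMatrixLog ((1 + B).map (algebraMap ℝ ℂ)) L ∧
      ∀ z ∈ spectrum ℂ (A.map (algebraMap ℝ ℂ) + ((p / ω : ℝ) : ℂ) • L), z.re < 0)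
    -- (A3)
    (hMf : 0 < Mf) (hMh : 0 < Mh)
    (hA3_f : ∀ t x, ‖f t x‖ ≤ Mf) (hA3_h : ∀ x, ‖h x‖ ≤ Mh)
    -- (A4)
    (hLf : 0 < Lf) (hLh : 0 < Lh)
    (hA4_f : ∀ t x₁ x₂, ‖f t x₁ - f t x₂‖ ≤ Lf * ‖x₁ - x₂‖)
    (hA4_h : ∀ x₁ x₂, ‖h x₁ - h x₂‖ ≤ Lh * ‖x₁ - x₂‖)
    -- the matriciant and the constants `N`, `lam` of its exponential decay (spectral norm)
    (hU : IsMatriciant A B θ U)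
    (hN : 0 < N) (hlam : 0 < lam)
    (hU_bound : ∀ s t : ℝ, s ≤ t → ‖U t s‖ ≤ N * Real.exp (-lam * (t - s)))
    -- (A5)
    (hA5 : N * (Lf / lam + p * Lh / (1 - Real.exp (-lam * ω))) < 1)
    -- (A6)
    (hA6 : N * Lf + p / ω * Real.log (1 + N * Lh) < lam)
    -- the bounded solution
    (φ : ℝ → EuclideanSpace ℝ (Fin m))
    (hφ : IsImpulsiveSolution A B f (stepPerturbation θ p σ) h θ φ)
    (hφ_bdd : ∃ C : ℝ, ∀ t, ‖φ t‖ ≤ C)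
    -- the sequence `ζ`
    (ζ : ℕ → ℤ) (hζ_pos : ∀ n, 0 < ζ n) (hζ : Tendsto ζ atTop atTop)
    (hσζ : ∀ k : ℤ, Tendsto (fun n => ‖σ (k + ζ n) - σ k‖) atTop (𝓝 0)) :
    ∀ K : Set ℝ, IsCompact K →
      TendstoUniformlyOn (fun (n : ℕ) (t : ℝ) => ‖φ (t + ω * ζ n) - φ t‖) (fun _ => 0)
        atTop K := by
  intro K hK
  obtain ⟨C, hC⟩ := hφ_bdd
  obtain ⟨J, hJ⟩ : IsUnit (Matrix.toEuclideanCLM (𝕜 := ℝ) (1 + B)) :=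
    (((Matrix.isUnit_iff_isUnit_det _).2 (isUnit_iff_ne_zero.2 hA1_det))).map
      (Matrix.toEuclideanCLM (n := Fin m) (𝕜 := ℝ))
  have hcomm : Commute (Matrix.toEuclideanCLM (𝕜 := ℝ) A) (J : _ →L[ℝ] _) := by
    rw [hJ]
    exact ((Commute.one_right A).add_right hA1_comm).map
      (Matrix.toEuclideanCLM (n := Fin m) (𝕜 := ℝ))
  rw [map_add, map_one] at hJ
  obtain ⟨κ, hκmono, hκ⟩ :=
    exists_stepPerturbation_index (E := EuclideanSpace ℝ (Fin m)) hθ hω hθ_per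
  obtain ⟨c, hc⟩ := hK.bddBelow
  obtain ⟨d, hd⟩ := hK.bddAbove
  rw [Metric.tendstoUniformlyOn_iff]
  intro η hη
  obtain ⟨s₀, ε, hε, H⟩ := exists_window_norm_lt hcomm hJ hθ hω hθ_per hU.isImpulsiveEvolution hN
    hlam hU_bound hLf hLh hA5 (2 * C) c d hη
  -- Only finitely many indices `k` are seen by the step function on `[s₀, d]`.
  have hev : ∀ᶠ n in atTop, ∀ k ∈ Finset.Icc (κ s₀) (κ d), ‖σ (k + ζ n) - σ k‖ < ε :=
    (Finset.eventually_all _).2 fun k _ => (hσζ k).eventually_lt_const hε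
  filter_upwards [hev] with n hn t ht
  rw [dist_zero_left, norm_norm]
  refine H _ _ _ (hφ.sub_shift hθ_per hf_per (ζ n)) (fun t => ?_) (fun r hr => ?_) (fun k => ?_) t
    ⟨hc ht, hd ht⟩
  · linarith [norm_sub_le (φ (t + ω * ζ n)) (φ t), hC t, hC (t + ω * ζ n)]
  · have h0 := hκ σ r 0
    rw [Int.cast_zero, mul_zero, add_zero, add_zero] at h0
    rw [hκ, h0]
    exact (norm_add_le _ _).trans (add_le_add (hA4_f _ _ _)
      (hn _ (Finset.mem_Icc.2 ⟨hκmono hr.1, hκmono hr.2⟩)).le)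
  · exact hA4_h _ _
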